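/- Let $L,m\ge 1$ and, for each $l=1,\dots,L$, let $\mathcal{E}^l=\{\eta_i^l,\rho_i^l\}_{i=1}^{n_l}$ be an ensemble of quantum states (density operators) on an $m$-party space $\bigotimes_{k=1}^m\mathbb{C}^{d_{l,k}}$ with probabilities $\eta_i^l>0$, $\sum_i\eta_i^l=1$. Let $$\bigotimes_{l=1}^L\mathcal{E}^l=\{\eta_{\vec c},\rho_{\vec c}\}_{\vec c},\qquad \eta_{\vec c}=\prod_{l=1}^L\eta^l_{c_l},\qquad \rho_{\vec c}=\bigotimes_{l=1}^L\rho^l_{c_l},\qquad \vec c=(c_1,\dots,c_L),\ 1\le c_l\le n_l,$$ be the sequence ensemble, regarded as an ensemble of $m$-party states in which party $k$ holds $\bigotimes_{l}\mathbb{C}^{d_{l,k}}$. For an ensemble $\mathcal{E}=\{\eta_i,\rho_i\}_i$, let $p_{\sf G}(\mathcal{E})$ be the maximum of $\sum_i\eta_i\operatorname{Tr}(\rho_iM_i)$ over all measurements $\{M_i\}_i$ ($M_i\ge 0$, $\sum_iM_i=\mathbb{1}$), and let $p_{\sf L}(\mathcal{E})$ be the supremum of the same quantity over all measurements that can be realized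 by local operations and classical communication (LOCC) among the $m$ parties, that is, by finitely many rounds in each of which one party performs a quantum instrument on its system and broadcasts the outcome, the other parties apply local channels, and all later operations, as well as the final guess, may depend on the outcomes broadcast so far. Assume that the optimal LOCC discrimination of $\bigotimes_l\mathcal{E}^l$ is factorizable, that is, $$p_{\sf L}\Big(\bigotimes_{l=1}^L\mathcal{E}^l\Big)=\prod_{l=1}^Lp_{\sf L}(\mathcal{E}^l).$$ Then $$\max_{\vec c}\eta_{\vec c}<p_{\sf L}\Big(\bigotimes_{l=1}^L\mathcal{E}^l\Big)<p_{\sf G}\Big(\bigotimes_{l=1}^L\mathcal{E}^l\Big)$$ holds if and only if there exist $l,l'\in\{1,\dots,L\}$ such that $$\max_{1\le i\le n_l}\eta_i^l<p_{\sf L}(\mathcal{E}^l)\qquad\text{and}\qquad p_{\sf L}(\mathcal{E}^{l'})<p_{\sf G}(\mathcal{E}^{l'}).$$ -/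

import Mathlib

open scoped Matrix ComplexOrder

namespace QuantumSequence

/-- Operators on the `m`-party space `⨂ₖ ℂ^{D k}`, as matrices in the product basis. -/
abbrev Op {m : ℕ} (D : Fin m → Type) : Type :=
  Matrix (∀ k, D k) (∀ k, D k) ℂ

/-- The product operator `⨂ₖ B k : ⨂ₖ ℂ^{D k} → ⨂ₖ ℂ^{D' k}`. -/
def tensorOp {m : ℕ} {D D' : Fin m → Type} (B : ∀ k, Matrix (D' k) (D k) ℂ) :
    Matrix (∀ k, D' k) (∀ k, D k) ℂ :=
  fun a b => ∏ k, B k (a k) (b k)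

/-- For operators `ρ l` on the `m`-party spaces `⨂ₖ ℂ^{D l k}`, the operator `⨂ₗ ρ l`, regarded as
an operator on an `m`-party space in which party `k` holds `⨂ₗ ℂ^{D l k}`. -/
def seqOp {L m : ℕ} {D : Fin L → Fin m → Type} (ρ : ∀ l, Op (D l)) :
    Op (fun k => ∀ l, D l k) :=
  fun a b => ∏ l, ρ l (fun k => a k l) (fun k => b k l)

/-- An ensemble of `m`-party quantum states with nonzero preparation probabilities. -/
structure Ensemble {m : ℕ} (D : Fin m → Type) [∀ k, Fintype (D k)] (ι : Type) [Fintype ι] where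
  prob : ι → ℝ
  state : ι → Op D
  prob_pos : ∀ i, 0 < prob i
  prob_sum : ∑ i, prob i = 1
  state_posSemidef : ∀ i, (state i).PosSemidef
  state_trace : ∀ i, (state i).trace = 1

/-- A measurement with outcomes in `ι`. -/
structure IsMeasurement {m : ℕ} {D : Fin m → Type} [∀ k, Fintype (D k)] [∀ k, DecidableEq (D k)]
    {ι : Type} [Fintype ι] (M : ι → Op D) : Prop where
  posSemidef : ∀ i, (M i).PosSemidef
  sum_eq_one : ∑ i, M i = 1

/-- `M` is the family of effects of an LOCC protocol with `r` rounds of communication.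

With no round left, the parties announce a guess `i` fixed by the transcript so far.  In a round,
some party `k` performs a quantum instrument and broadcasts its outcome `x`; each other party `j`
then applies a trace-preserving completely positive map that may depend on `x`; and the parties
continue with an LOCC protocol `N x` that may depend on `x`.  All maps are given by Kraus operators
`B x j s`, and the dimensions `e x j` of the local spaces after the round are arbitrary. -/
def IsLOCCRounds {m : ℕ} {ι : Type} [DecidableEq ι] :
    ℕ → ∀ (D : Fin m → Type) [∀ k, Fintype (D k)] [∀ k, DecidableEq (D k)], (ι → Op D) → Prop
  | 0, _, _, _, M => ∃ i, M = Pi.single i 1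
  | r + 1, D, _, _, M =>
      ∃ (k : Fin m) (q : ℕ) (e t : Fin q → Fin m → ℕ)
        (B : ∀ x j, Fin (t x j) → Matrix (Fin (e x j)) (D j) ℂ)
        (N : ∀ x, ι → Op (fun j => Fin (e x j))),
        (∑ x, ∑ s, (B x k s)ᴴ * B x k s = 1) ∧
        (∀ x, ∀ j, j ≠ k → ∑ s, (B x j s)ᴴ * B x j s = 1) ∧
        (∀ x, IsLOCCRounds r (fun j => Fin (e x j)) (N x)) ∧
        ∀ i, M i = ∑ x, ∑ s : (∀ j, Fin (t x j)),
          (tensorOp fun j => B x j (s j))ᴴ * N x i * tensorOp fun j => B x j (s j)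

/-- A measurement that can be realized by LOCC (with finitely many rounds). -/
def IsLOCCMeasurement {m : ℕ} {D : Fin m → Type} [∀ k, Fintype (D k)] [∀ k, DecidableEq (D k)]
    {ι : Type} [Fintype ι] [DecidableEq ι] (M : ι → Op D) : Prop :=
  IsMeasurement M ∧ ∃ r, IsLOCCRounds r D M

section Discrimination

variable {m : ℕ} {D : Fin m → Type} [∀ k, Fintype (D k)] [∀ k, DecidableEq (D k)]
  {ι : Type} [Fintype ι] [DecidableEq ι]

/-- The average probability of guessing the prepared state correctly with `M`. -/
noncomputable def Ensemble.success (E : Ensemble D ι) (M : ι → Op D) : ℝ :=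
  ∑ i, E.prob i * (E.state i * M i).trace.re

/-- The optimal success probability over all measurements. -/
noncomputable def Ensemble.pG (E : Ensemble D ι) : ℝ :=
  sSup {p | ∃ M : ι → Op D, IsMeasurement M ∧ p = E.success M}

/-- The optimal success probability over all LOCC measurements.  The set of LOCC measurements need
not be closed, so this is a supremum; since the success probability is continuous in the
measurement, adding limits of finite-round protocols would not change its value. -/
noncomputable def Ensemble.pL (E : Ensemble D ι) : ℝ :=
  sSup {p | ∃ M : ι → Op D, IsLOCCMeasurement M ∧ p = E.success M}

end Discrimination

section Factor

open scoped MatrixOrder Matrix.Norms.L2Operator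

theorem exists_eq_conjTranspose_mul_self {n : Type} [Fintype n] {A : Matrix n n ℂ}
    (hA : A.PosSemidef) : ∃ B : Matrix n n ℂ, A = Bᴴ * B := by
  classical
  exact CStarAlgebra.nonneg_iff_eq_star_mul_self.mp hA.nonneg

end Factor

section Sequence

variable {L m : ℕ} {D : Fin L → Fin m → Type} [∀ l k, Fintype (D l k)]

theorem seqOp_posSemidef {ρ : ∀ l, Op (D l)} (h : ∀ l, (ρ l).PosSemidef) :
    (seqOp ρ).PosSemidef := by
  classical
  choose B hB using fun l => exists_eq_conjTranspose_mul_self (h l)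
  have key : seqOp ρ = (seqOp B)ᴴ * seqOp B := by
    ext a b
    simp only [seqOp, Matrix.mul_apply, Matrix.conjTranspose_apply, star_prod,
      ← Finset.prod_mul_distrib]
    rw [← (Equiv.piComm fun (l : Fin L) (k : Fin m) => D l k).sum_comp]
    simp only [hB, Matrix.mul_apply, Matrix.conjTranspose_apply]
    rw [Finset.prod_univ_sum, Fintype.piFinset_univ]
    rfl
  rw [key]
  exact Matrix.posSemidef_conjTranspose_mul_self _

theorem seqOp_trace (ρ : ∀ l, Op (D l)) : (seqOp ρ).trace = ∏ l, (ρ l).trace := by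
  classical
  simp only [Matrix.trace, Matrix.diag_apply, seqOp]
  rw [← (Equiv.piComm fun (l : Fin L) (k : Fin m) => D l k).sum_comp, Finset.prod_univ_sum,
    Fintype.piFinset_univ]
  rfl

/-- The sequence ensemble `⨂ₗ E l`: the state `⨂ₗ ρ_{c l}` is prepared with probability
`∏ₗ η_{c l}`, and party `k` holds the `k`-th subsystems of all `L` states. -/
def seqEnsemble {n : Fin L → ℕ} (E : ∀ l, Ensemble (D l) (Fin (n l))) :
    Ensemble (fun k => ∀ l, D l k) (∀ l, Fin (n l)) where
  prob c := ∏ l, (E l).prob (c l)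
  state c := seqOp fun l => (E l).state (c l)
  prob_pos c := Finset.prod_pos fun l _ => (E l).prob_pos (c l)
  prob_sum := by
    classical
    have h := Finset.prod_univ_sum (fun l => (Finset.univ : Finset (Fin (n l))))
      fun l i => (E l).prob i
    rw [Fintype.piFinset_univ] at h
    rw [← h]
    exact Finset.prod_eq_one fun l _ => (E l).prob_sum
  state_posSemidef c := seqOp_posSemidef fun l => (E l).state_posSemidef (c l)
  state_trace c := by
    rw [seqOp_trace]
    exact Finset.prod_eq_one fun l _ => (E l).state_trace (c l)

/-- The optimal LOCC discrimination of `⨂ₗ E l` is factorizable. -/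
def IsFactorizable [∀ l k, DecidableEq (D l k)] {n : Fin L → ℕ}
    (E : ∀ l, Ensemble (D l) (Fin (n l))) : Prop :=
  (seqEnsemble E).pL = ∏ l, (E l).pL

end Sequence

end QuantumSequence

/-! All three quantities are products over `l`: the largest prior because the maximum can be taken
factor by factor, `pL` by hypothesis, and `pG` by `pG_seqEnsemble`. In each factor `0 < max prior ≤
pL ≤ pG`, and a product of positive numbers increases strictly under factorwise `≤` exactly when
some factor does (`prod_lt_prod_iff_exists_lt`). Applied to each inequality separately, this gives
the two indices.

The quantum content is `pG ≤ ∏ pG`. By `Ensemble.exists_dual` each ensemble has an operator `K l`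
that dominates every weighted state and has trace `pG`. Then `seqOp K` dominates every weighted
state of the sequence, so its trace `∏ pG` bounds every success probability. The dual operator comes
from the first-order optimality condition at a best measurement. -/

namespace QuantumSequence

/-! ### Positive semidefinite matrices -/

section PosSemidef

variable {n : Type} [Fintype n]

theorem trace_mul_nonneg {A B : Matrix n n ℂ} (hA : A.PosSemidef) (hB : B.PosSemidef) :
    0 ≤ (A * B).trace := by
  obtain ⟨C, rfl⟩ := exists_eq_conjTranspose_mul_self hA
  rw [Matrix.mul_assoc, Matrix.trace_mul_comm]
  exact (hB.mul_mul_conjTranspose_same C).trace_nonneg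

theorem trace_mul_eq_ofReal {A B : Matrix n n ℂ} (hA : A.PosSemidef) (hB : B.PosSemidef) :
    (A * B).trace = ((A * B).trace.re : ℂ) :=
  Complex.ext rfl (by simpa using (Complex.le_def.mp (trace_mul_nonneg hA hB)).2.symm)

theorem isClosed_posSemidef : IsClosed {A : Matrix n n ℂ | A.PosSemidef} := by
  simp only [Matrix.posSemidef_iff_dotProduct_mulVec, Set.ofPred_and, Set.ofPred_forall]
  refine IsClosed.inter ?_ (isClosed_iInter fun x => ?_)
  · exact isClosed_eq (by fun_prop) continuous_id
  · simp only [Complex.le_def, Set.ofPred_and]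
    exact (isClosed_le (by fun_prop) (by fun_prop)).inter
      (isClosed_eq (by fun_prop) (by fun_prop))

/-- A Hermitian matrix is positive semidefinite if its pairing with every orthogonal projection is
nonnegative. -/
theorem posSemidef_of_forall_projection {W : Matrix n n ℂ} (hW : W.IsHermitian)
    (h : ∀ P : Matrix n n ℂ, P.PosSemidef → P * P = P → 0 ≤ (P * W).trace.re) :
    W.PosSemidef := by
  refine Matrix.PosSemidef.of_dotProduct_mulVec_nonneg hW fun x => ?_
  obtain rfl | hx := eq_or_ne x 0
  · simp
  have hpos : 0 < star x ⬝ᵥ x := Matrix.dotProduct_star_self_pos_iff.mpr hx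
  obtain ⟨r, hr0, hr⟩ : ∃ r : ℝ, 0 < r ∧ star x ⬝ᵥ x = (r : ℂ) :=
    ⟨(star x ⬝ᵥ x).re, (Complex.lt_def.mp hpos).1,
      Complex.ext rfl (by simpa using (Complex.lt_def.mp hpos).2.symm)⟩
  have hrc : (r : ℂ) ≠ 0 := by exact_mod_cast hr0.ne'
  -- Test against the orthogonal projection onto the line spanned by `x`, where `r` is the squared
  -- norm of `x`.
  have hP := h (((r⁻¹ : ℝ) : ℂ) • Matrix.vecMulVec x (star x))
    ((Matrix.posSemidef_vecMulVec_self_star x).smul (by exact_mod_cast (inv_pos.mpr hr0).le))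
    (by
      rw [Matrix.smul_mul, Matrix.mul_smul, Matrix.vecMulVec_mul_vecMulVec, hr,
        Matrix.vecMulVec_smul, smul_smul (_ : ℂ) (r : ℂ)]
      push_cast
      rw [inv_mul_cancel₀ hrc, one_smul])
  have him : (star x ⬝ᵥ W *ᵥ x).im = 0 := hW.im_star_dotProduct_mulVec_self x
  rw [Matrix.smul_mul, Matrix.trace_smul, Matrix.vecMulVec_mul, Matrix.trace_vecMulVec,
    dotProduct_comm, ← Matrix.dotProduct_mulVec, smul_eq_mul, Complex.re_ofReal_mul] at hP
  exact Complex.le_def.mpr ⟨nonneg_of_mul_nonneg_right hP (inv_pos.mpr hr0), him.symm⟩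

end PosSemidef

/-! ### Compactness of the set of measurements -/

section Compactness

open scoped MatrixOrder Matrix.Norms.L2Operator

theorem isCompact_isMeasurement {m : ℕ} {D : Fin m → Type} [∀ k, Fintype (D k)]
    [∀ k, DecidableEq (D k)] {ι : Type} [Fintype ι] :
    IsCompact {M : ι → Op D | IsMeasurement M} := by
  have hset : {M : ι → Op D | IsMeasurement M} =
      {M | ∀ i, (M i).PosSemidef} ∩ {M | ∑ i, M i = 1} :=
    Set.ext fun M => ⟨fun h => ⟨h.1, h.2⟩, fun h => ⟨h.1, h.2⟩⟩
  have : ProperSpace (ι → Op D) := FiniteDimensional.proper ℂ _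
  refine Metric.isCompact_of_isClosed_isBounded ?_ ?_
  · rw [hset, Set.ofPred_forall]
    have hc : Continuous fun M : ι → Op D => ∑ i, M i :=
      continuous_finsetSum _ fun i _ => continuous_apply i
    exact (isClosed_iInter fun i => isClosed_posSemidef.preimage (continuous_apply i)).inter
      (isClosed_eq hc continuous_const)
  · refine (Metric.isBounded_closedBall (x := (0 : ι → Op D)) (r := 1)).subset fun M hM => ?_
    rw [mem_closedBall_zero_iff, pi_norm_le_iff_of_nonneg zero_le_one]
    intro i
    have h0 : ∀ j, 0 ≤ M j := fun j => (hM.posSemidef j).nonneg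
    -- Boundedness: each effect lies between `0` and `1`, hence has operator norm at most `1`.
    refine (CStarAlgebra.norm_le_one_iff_of_nonneg (M i) (h0 i)).mpr ?_
    rw [← hM.sum_eq_one]
    exact Finset.single_le_sum (fun j _ => h0 j) (Finset.mem_univ i)

end Compactness

/-! ### Optimal measurements and strong duality -/

section Discrimination

variable {m : ℕ} {D : Fin m → Type} [∀ k, Fintype (D k)] {ι : Type} [Fintype ι]

theorem Ensemble.nonempty_index (E : Ensemble D ι) : Nonempty ι := by
  by_contra h
  rw [not_nonempty_iff] at h
  simpa using E.prob_sum

theorem Ensemble.posSemidef_prob_smul_state (E : Ensemble D ι) (i : ι) :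
    ((E.prob i : ℂ) • E.state i).PosSemidef :=
  (E.state_posSemidef i).smul (by exact_mod_cast (E.prob_pos i).le)

variable [∀ k, DecidableEq (D k)]

theorem isMeasurement_single [DecidableEq ι] (i : ι) :
    IsMeasurement (Pi.single i 1 : ι → Op D) where
  posSemidef j := by
    obtain rfl | h := eq_or_ne j i
    · simpa using Matrix.PosSemidef.one
    · simpa [h] using Matrix.PosSemidef.zero
  sum_eq_one := by simp

/-- The optimal success probability is attained by some measurement. -/
theorem Ensemble.exists_success_eq_pG (E : Ensemble D ι) :
    ∃ M, IsMeasurement M ∧ E.success M = E.pG ∧ ∀ N, IsMeasurement N → E.success N ≤ E.pG := by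
  classical
  obtain ⟨i⟩ := E.nonempty_index
  have hc : Continuous fun M : ι → Op D => E.success M := by
    unfold Ensemble.success
    exact continuous_finsetSum _ fun i _ => continuous_const.mul
      (Complex.continuous_re.comp (Continuous.matrix_trace
        (continuous_const.matrix_mul (continuous_apply i))))
  obtain ⟨M, hM, hmax⟩ := isCompact_isMeasurement.exists_isMaxOn
    ⟨_, isMeasurement_single i⟩ hc.continuousOn
  have hg : IsGreatest {p | ∃ M : ι → Op D, IsMeasurement M ∧ p = E.success M} (E.success M) :=
    ⟨⟨M, hM, rfl⟩, by rintro _ ⟨N, hN, rfl⟩; exact hmax hN⟩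
  refine ⟨M, hM, hg.csSup_eq.symm, fun N hN => ?_⟩
  rw [Ensemble.pG, hg.csSup_eq]
  exact hmax hN

theorem Ensemble.success_le_pG (E : Ensemble D ι) {M : ι → Op D} (hM : IsMeasurement M) :
    E.success M ≤ E.pG := by
  obtain ⟨-, -, -, h⟩ := E.exists_success_eq_pG
  exact h M hM

theorem Ensemble.success_single [DecidableEq ι] (E : Ensemble D ι) (i : ι) :
    E.success (Pi.single i 1) = E.prob i := by
  rw [Ensemble.success, Finset.sum_eq_single i]
  · simp [E.state_trace]
  · intro j _ h
    simp [h]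
  · simp

/-- Guessing `i` without looking is an LOCC protocol with zero rounds. -/
theorem Ensemble.prob_le_pL [DecidableEq ι] (E : Ensemble D ι) (i : ι) : E.prob i ≤ E.pL := by
  refine le_csSup ⟨E.pG, ?_⟩ ⟨Pi.single i 1, ⟨isMeasurement_single i, 0, ?_⟩, ?_⟩
  · rintro _ ⟨M, hM, rfl⟩
    exact E.success_le_pG hM.1
  · exact ⟨i, rfl⟩
  · exact (E.success_single i).symm

theorem Ensemble.pL_le_pG [DecidableEq ι] (E : Ensemble D ι) : E.pL ≤ E.pG := by
  obtain ⟨i⟩ := E.nonempty_index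
  refine csSup_le ⟨_, Pi.single i 1, ⟨isMeasurement_single i, 0, ?_⟩, rfl⟩ ?_
  · exact ⟨i, rfl⟩
  · rintro _ ⟨M, hM, rfl⟩
    exact E.success_le_pG hM.1

theorem Ensemble.success_eq_sum (E : Ensemble D ι) (M : ι → Op D) :
    E.success M = ∑ i, (((E.prob i : ℂ) • E.state i) * M i).trace.re := by
  simp [Ensemble.success, Matrix.trace_smul]

/-- Mixing a measurement `M` with a projection `P`: for `0 ≤ ε ≤ 2`, compressing `M` by `1 - ε P`
and assigning the missing weight to the outcome `j` gives a measurement. -/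
theorem IsMeasurement.compress [DecidableEq ι] {M : ι → Op D} (hM : IsMeasurement M) {P : Op D}
    (hP : P.PosSemidef) (hPP : P * P = P) (j : ι) {ε : ℝ} (h0 : 0 ≤ ε) (h2 : ε ≤ 2) :
    IsMeasurement fun i => (1 - (ε : ℂ) • P) * M i * (1 - (ε : ℂ) • P) +
      (Pi.single j (((2 * ε - ε ^ 2 : ℝ) : ℂ) • P) : ι → Op D) i where
  posSemidef i := by
    have hH : (1 - (ε : ℂ) • P)ᴴ = 1 - (ε : ℂ) • P := by
      rw [Matrix.conjTranspose_sub, Matrix.conjTranspose_one, Matrix.conjTranspose_smul,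
        hP.isHermitian.eq, Complex.star_def, Complex.conj_ofReal]
    refine Matrix.PosSemidef.add ?_ ?_
    · have h := (hM.posSemidef i).mul_mul_conjTranspose_same (1 - (ε : ℂ) • P)
      rwa [hH] at h
    · obtain rfl | h := eq_or_ne i j
      · rw [Pi.single_eq_same]
        refine hP.smul ?_
        have : 0 ≤ 2 * ε - ε ^ 2 := by nlinarith
        exact_mod_cast this
      · simpa [h] using Matrix.PosSemidef.zero
  sum_eq_one := by
    -- Since `P` is idempotent, `(1 - ε P)² = 1 - (2 ε - ε²) P`, and the added term restores the
    -- deficit.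
    rw [Finset.sum_add_distrib, ← Finset.sum_mul, ← Finset.mul_sum, hM.sum_eq_one,
      Finset.sum_pi_single']
    rw [if_pos (Finset.mem_univ j)]
    simp only [mul_one, sub_mul, mul_sub, one_mul, Matrix.smul_mul, Matrix.mul_smul, hPP]
    push_cast
    module

theorem nonneg_of_forall_add_mul_nonneg {a b : ℝ}
    (h : ∀ ε : ℝ, 0 < ε → ε ≤ 2 → 0 ≤ a + ε * b) : 0 ≤ a := by
  have ht : Filter.Tendsto (fun ε : ℝ => a + ε * b) (nhdsWithin 0 (Set.Ioi 0)) (nhds a) := by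
    have : Continuous fun ε : ℝ => a + ε * b := by fun_prop
    simpa using (this.tendsto 0).mono_left nhdsWithin_le_nhds
  refine ge_of_tendsto ht ?_
  filter_upwards [Ioc_mem_nhdsGT (show (0 : ℝ) < 2 by norm_num)] with ε hε
  exact h ε hε.1 hε.2

/-- Strong duality for minimum-error discrimination, dual attainment. -/
theorem Ensemble.exists_dual (E : Ensemble D ι) :
    ∃ K : Op D, (∀ i, (K - (E.prob i : ℂ) • E.state i).PosSemidef) ∧ K.trace.re = E.pG := by
  classical
  obtain ⟨M, hM, hMp, hmax⟩ := E.exists_success_eq_pG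
  set A : ι → Op D := fun i => (E.prob i : ℂ) • E.state i
  have hA : ∀ i, (A i)ᴴ = A i := fun i => (E.posSemidef_prob_smul_state i).isHermitian.eq
  have hsucc : ∀ N, E.success N = (∑ i, A i * N i).trace.re := fun N => by
    rw [E.success_eq_sum, Matrix.trace_sum, Complex.re_sum]
  -- `S` is not known to be Hermitian, so the dual operator will be its Hermitian part `(S + T) /
  -- 2`.
  set S : Op D := ∑ i, A i * M i with hS
  set T : Op D := ∑ i, M i * A i with hT
  have hST : Sᴴ = T := by
    simp [hS, hT, Matrix.conjTranspose_sum, hA, (hM.posSemidef _).isHermitian.eq]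
  have hTS : Tᴴ = S := by rw [← hST, Matrix.conjTranspose_conjTranspose]
  have htrT : T.trace = S.trace := by
    rw [hS, hT, Matrix.trace_sum, Matrix.trace_sum]
    exact Finset.sum_congr rfl fun i _ => Matrix.trace_mul_comm _ _
  -- First-order condition: moving weight along `P` to outcome `j` cannot improve `M`. Here `b` is
  -- the second-order coefficient, which vanishes in the limit after division by `ε`.
  have hvar : ∀ (j : ι) (P : Op D), P.PosSemidef → P * P = P →
      0 ≤ (P * (S + T - (2 : ℂ) • A j)).trace.re := by
    intro j P hP hPP
    refine nonneg_of_forall_add_mul_nonneg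
      (b := (P * A j).trace.re - (∑ i, A i * (P * M i * P)).trace.re) fun ε h0 h2 => ?_
    have h := hmax _ (hM.compress hP hPP j h0.le h2)
    rw [← hMp, hsucc, hsucc] at h
    have hexp : (∑ i, A i * ((1 - (ε : ℂ) • P) * M i * (1 - (ε : ℂ) • P) +
        (Pi.single j (((2 * ε - ε ^ 2 : ℝ) : ℂ) • P) : ι → Op D) i)).trace =
        S.trace - ε * (P * (S + T - (2 : ℂ) • A j)).trace
          - ε ^ 2 * ((P * A j).trace - (∑ i, A i * (P * M i * P)).trace) := by
      have h1 : ∀ i, (A i * ((1 - (ε : ℂ) • P) * M i * (1 - (ε : ℂ) • P))).trace =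
          (A i * M i).trace - ε * (P * (A i * M i)).trace - ε * (P * (M i * A i)).trace
            + ε ^ 2 * (A i * (P * M i * P)).trace := by
        intro i
        have e1 : (P * (A i * M i)).trace = (A i * (M i * P)).trace := by
          rw [Matrix.trace_mul_comm, Matrix.mul_assoc]
        have e2 : (P * (M i * A i)).trace = (A i * (P * M i)).trace := by
          rw [← Matrix.mul_assoc, Matrix.trace_mul_comm]
        rw [e1, e2]
        simp only [sub_mul, mul_sub, one_mul, mul_one, Matrix.smul_mul, Matrix.mul_smul,
          Matrix.trace_sub, Matrix.trace_smul, smul_eq_mul]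
        ring
      have h3 : (∑ i, A i * (Pi.single j (((2 * ε - ε ^ 2 : ℝ) : ℂ) • P) : ι → Op D) i).trace =
          (2 * ε - ε ^ 2) * (P * A j).trace := by
        rw [Finset.sum_eq_single j (fun i _ hi => by simp [hi]) (by simp), Pi.single_eq_same,
          Matrix.mul_smul, Matrix.trace_smul, Matrix.trace_mul_comm]
        simp
      simp only [mul_add (A _), Finset.sum_add_distrib]
      rw [Matrix.trace_add, h3, Matrix.trace_sum]
      simp only [h1, Finset.sum_add_distrib, Finset.sum_sub_distrib, hS, hT,
        mul_sub P, mul_add P, Matrix.trace_sub, Matrix.trace_add,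
        Matrix.trace_sum, Matrix.mul_smul, Matrix.trace_smul, smul_eq_mul, Matrix.mul_sum]
      simp only [← Finset.mul_sum]
      ring
    rw [hexp, ← hS, ← Complex.ofReal_pow] at h
    simp only [Complex.sub_re, Complex.re_ofReal_mul] at h
    refine le_of_mul_le_mul_left ?_ h0
    linarith
  refine ⟨(1 / 2 : ℂ) • (S + T), fun j => ?_, ?_⟩
  · have hW : ((1 / 2 : ℂ) • (S + T) - A j).IsHermitian := by
      rw [Matrix.IsHermitian, Matrix.conjTranspose_sub, Matrix.conjTranspose_smul,
        Matrix.conjTranspose_add, hST, hTS, hA, add_comm]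
      simp
    refine posSemidef_of_forall_projection hW fun P hP hPP => ?_
    have h := hvar j P hP hPP
    rw [show S + T - (2 : ℂ) • A j = (2 : ℂ) • ((1 / 2 : ℂ) • (S + T) - A j) by module,
      Matrix.mul_smul, Matrix.trace_smul] at h
    rw [smul_eq_mul, ← Complex.ofReal_ofNat, Complex.re_ofReal_mul] at h
    exact nonneg_of_mul_nonneg_right h two_pos
  · rw [Matrix.trace_smul, Matrix.trace_add, htrT, ← hMp, hsucc, ← hS]
    simp [← two_mul]

end Discrimination

/-! ### Tensor products and multiplicativity -/

section Sequence

variable {L m : ℕ} {D : Fin L → Fin m → Type}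

theorem sum_seqOp {ι : Fin L → Type} [∀ l, Fintype (ι l)] (M : ∀ l, ι l → Op (D l)) :
    ∑ c : ∀ l, ι l, seqOp (fun l => M l (c l)) = seqOp fun l => ∑ i, M l i := by
  classical
  ext a b
  simp only [seqOp, Matrix.sum_apply]
  rw [Finset.prod_univ_sum, Fintype.piFinset_univ]

theorem seqOp_one [∀ l k, DecidableEq (D l k)] : seqOp (fun l => (1 : Op (D l))) = 1 := by
  ext a b
  simp only [seqOp, Matrix.one_apply, Finset.prod_ite_zero, Finset.prod_const_one]
  refine if_congr ?_ rfl rfl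
  simp only [funext_iff, Finset.mem_univ, true_imp_iff]
  exact forall_comm

theorem seqOp_smul (z : Fin L → ℂ) (A : ∀ l, Op (D l)) :
    seqOp (fun l => z l • A l) = (∏ l, z l) • seqOp A := by
  ext a b
  simp [seqOp, Finset.prod_mul_distrib]

variable [∀ l k, Fintype (D l k)]

theorem seqOp_mul (A B : ∀ l, Op (D l)) :
    seqOp A * seqOp B = seqOp fun l => A l * B l := by
  classical
  ext a b
  simp only [seqOp, Matrix.mul_apply, ← Finset.prod_mul_distrib]
  -- Regroup indices from party-first to ensemble-first, so that the sum of products becomes a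
  -- product of sums.
  rw [← (Equiv.piComm fun (l : Fin L) (k : Fin m) => D l k).sum_comp, Finset.prod_univ_sum,
    Fintype.piFinset_univ]
  rfl

theorem seqOp_sub_posSemidef {A K : ∀ l, Op (D l)} (hA : ∀ l, (A l).PosSemidef)
    (hK : ∀ l, (K l - A l).PosSemidef) : (seqOp K - seqOp A).PosSemidef := by
  classical
  -- Expand the tensor product of `A l + (K l - A l)` into `2 ^ L` positive semidefinite terms; the
  -- all-`true` term is `seqOp A`.
  have h := sum_seqOp fun l (b : Bool) => bif b then A l else K l - A l
  simp only [Fintype.sum_bool, cond_true, cond_false, add_sub_cancel] at h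
  rw [← h, ← Finset.add_sum_erase _ _ (Finset.mem_univ fun _ => true)]
  simp only [cond_true, add_sub_cancel_left]
  refine Matrix.posSemidef_sum _ fun c _ => seqOp_posSemidef fun l => ?_
  cases c l
  exacts [hK l, hA l]

variable {n : Fin L → ℕ}

theorem iSup_prob_seqEnsemble (E : ∀ l, Ensemble (D l) (Fin (n l))) :
    ⨆ c, (seqEnsemble E).prob c = ∏ l, ⨆ i, (E l).prob i := by
  have := fun l => (E l).nonempty_index
  apply le_antisymm
  · exact ciSup_le fun c => Finset.prod_le_prod (s := Finset.univ)
      (fun l _ => ((E l).prob_pos (c l)).le) fun l _ => le_ciSup (Finite.bddAbove_range _) (c l)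
  · choose c hc using fun l => exists_eq_ciSup_of_finite (f := (E l).prob)
    simp only [← hc]
    exact le_ciSup (f := (seqEnsemble E).prob) (Finite.bddAbove_range _) c

variable [∀ l k, DecidableEq (D l k)]

theorem IsMeasurement.seqOp {M : ∀ l, Fin (n l) → Op (D l)} (hM : ∀ l, IsMeasurement (M l)) :
    IsMeasurement fun c : ∀ l, Fin (n l) => seqOp fun l => M l (c l) where
  posSemidef c := seqOp_posSemidef fun l => (hM l).posSemidef (c l)
  sum_eq_one := by
    rw [sum_seqOp]
    simp only [(hM _).sum_eq_one]
    exact seqOp_one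

theorem success_seqEnsemble (E : ∀ l, Ensemble (D l) (Fin (n l)))
    {M : ∀ l, Fin (n l) → Op (D l)} (hM : ∀ l, IsMeasurement (M l)) :
    (seqEnsemble E).success (fun c => seqOp fun l => M l (c l)) =
      ∏ l, (E l).success (M l) := by
  simp only [Ensemble.success]
  rw [Finset.prod_univ_sum, Fintype.piFinset_univ]
  refine Finset.sum_congr rfl fun c _ => ?_
  simp only [seqEnsemble, seqOp_mul, seqOp_trace, Finset.prod_mul_distrib]
  congr 1
  -- The real part passes through the product because each trace is real.
  rw [Finset.prod_congr rfl fun l _ =>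
    trace_mul_eq_ofReal ((E l).state_posSemidef (c l)) ((hM l).posSemidef (c l)),
    ← Complex.ofReal_prod, Complex.ofReal_re]

/-- The optimal success probability over all measurements is multiplicative. -/
theorem pG_seqEnsemble (E : ∀ l, Ensemble (D l) (Fin (n l))) :
    (seqEnsemble E).pG = ∏ l, (E l).pG := by
  apply le_antisymm
  · choose K hK hKp using fun l => (E l).exists_dual
    obtain ⟨M, hM, hMp, -⟩ := (seqEnsemble E).exists_success_eq_pG
    -- `K l` is a weighted state plus a positive semidefinite gap; positivity makes its trace real,
    -- as the product of traces requires.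
    have hKpos : ∀ l, (K l).PosSemidef := fun l => by
      obtain ⟨i⟩ := (E l).nonempty_index
      simpa using (hK l i).add ((E l).posSemidef_prob_smul_state i)
    have hKtr : ∀ l, (K l).trace = ((E l).pG : ℂ) := fun l => by
      have := trace_mul_eq_ofReal (hKpos l) Matrix.PosSemidef.one
      rwa [mul_one, hKp] at this
    have hle : ∀ c, (((seqEnsemble E).prob c : ℂ) • (seqEnsemble E).state c * M c).trace.re ≤
        (seqOp K * M c).trace.re := fun c => by
      have hs : ((seqEnsemble E).prob c : ℂ) • (seqEnsemble E).state c =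
          seqOp fun l => ((E l).prob (c l) : ℂ) • (E l).state (c l) := by
        rw [seqOp_smul, ← Complex.ofReal_prod]
        rfl
      have h := trace_mul_nonneg (seqOp_sub_posSemidef
        (fun l => (E l).posSemidef_prob_smul_state (c l)) fun l => hK l (c l)) (hM.posSemidef c)
      rw [sub_mul, Matrix.trace_sub] at h
      rw [hs]
      simpa using (Complex.le_def.mp h).1
    calc (seqEnsemble E).pG
        = ∑ c, (((seqEnsemble E).prob c : ℂ) • (seqEnsemble E).state c * M c).trace.re := by
          rw [← hMp, Ensemble.success_eq_sum]
      _ ≤ ∑ c, (seqOp K * M c).trace.re := Finset.sum_le_sum fun c _ => hle c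
      _ = ∏ l, (E l).pG := by
          rw [← Complex.re_sum, ← Matrix.trace_sum, ← Finset.mul_sum, hM.sum_eq_one, mul_one,
            seqOp_trace]
          simp only [hKtr]
          rw [← Complex.ofReal_prod, Complex.ofReal_re]
  · choose M hM hMp _ using fun l => (E l).exists_success_eq_pG
    simp only [← hMp]
    rw [← success_seqEnsemble E hM]
    exact (seqEnsemble E).success_le_pG (IsMeasurement.seqOp hM)

end Sequence

theorem prod_lt_prod_iff_exists_lt {ι : Type*} [Fintype ι] {f g : ι → ℝ} (hf : ∀ i, 0 < f i)
    (hfg : ∀ i, f i ≤ g i) : ∏ i, f i < ∏ i, g i ↔ ∃ i, f i < g i := by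
  refine ⟨fun h => ?_, fun ⟨i, hi⟩ => Finset.prod_lt_prod (fun i _ => hf i) (fun i _ => hfg i)
    ⟨i, Finset.mem_univ i, hi⟩⟩
  by_contra! hgf
  exact h.not_ge (Finset.prod_le_prod (fun i _ => (hf i).le.trans (hfg i)) fun i _ => hgf i)

end QuantumSequence

open QuantumSequence in
theorem corollary2 {L m : ℕ} (d : Fin L → Fin m → ℕ) (n : Fin L → ℕ)
    (E : ∀ l, QuantumSequence.Ensemble (fun k => Fin (d l k)) (Fin (n l)))
    (hE : QuantumSequence.IsFactorizable E) :
    ((⨆ c, (QuantumSequence.seqEnsemble E).prob c) < (QuantumSequence.seqEnsemble E).pL ∧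
      (QuantumSequence.seqEnsemble E).pL < (QuantumSequence.seqEnsemble E).pG) ↔
    ∃ l l' : Fin L, (⨆ i, (E l).prob i) < (E l).pL ∧ (E l').pL < (E l').pG := by
  have hne := fun l => (E l).nonempty_index
  have hpos : ∀ l, 0 < ⨆ i, (E l).prob i := fun l =>
    ((E l).prob_pos (Classical.arbitrary _)).trans_le (le_ciSup (Finite.bddAbove_range _) _)
  have hL : ∀ l, ⨆ i, (E l).prob i ≤ (E l).pL := fun l => ciSup_le (E l).prob_le_pL
  rw [show (seqEnsemble E).pL = _ from hE, pG_seqEnsemble, iSup_prob_seqEnsemble,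
    prod_lt_prod_iff_exists_lt hpos hL,
    prod_lt_prod_iff_exists_lt (fun l => (hpos l).trans_le (hL l)) fun l => (E l).pL_le_pG]
  simp only [exists_and_left, exists_and_right]
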